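/- **Theorem.** Consider a uniprocessor with fixed-priority preemptive scheduling and $n \ge 1$ sporadic tasks $\tau_1,\dots,\tau_n$, indexed from highest to lowest priority. For $i<n$, $\tau_i$ is an ordinary sporadic task with worst-case execution time $C_i>0$ and minimum inter-arrival time $T_i>0$. The lowest-priority task $\tau_n$ has minimum inter-arrival time $T_n>0$ and is a segmented self-suspending task: each of its jobs consists of $m\ge 1$ computation segments with worst-case execution times $C_n^1,\dots,C_n^m>0$, separated by $m-1$ suspension intervals of lengths at most $S_n^1,\dots,S_n^{m-1}\ge 0$. In a valid release pattern every task releases an infinite sequence of jobs, consecutive releases of $\tau_i$ are at least $T_i$ apart, and the actual execution and suspension times lie between $0$ and their worst-case values. At each time the processor executes the highest-priority pending work (jobs of the same task in order of release), and idles only if no work is pending. The first segment of a job of $\tau_n$ is ready at the release of the job, and each later one when the suspension following the completion of the preceding segment ends. The response time of a job is its finishing time minus its release time ($+\infty$ if it never finishes), and $WCRT_n$ is the supremum of the response times of all jobs of $\tau_n$ over all valid release patterns. Consider the mixed-integer linear program (MILP) with real variables $g_j, f_j, r_{i,j}$ and non-negative integer variables $N_{i,j}$ ($1\le i\le n-1$,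 $1\le j\le m$): $$\text{maximize } f_m \quad\text{subject to}$$ $$r_{i,j}\ge g_j,\qquad 0\le N_{i,j}\le \left\lceil \frac{f_j-r_{i,j}}{T_i}\right\rceil \qquad (1\le i\le n-1,\ 1\le j\le m),$$ $$N_{i,j}\le \frac{r_{i,j+1}-r_{i,j}}{T_i}\qquad (1\le i\le n-1,\ 1\le j\le m-1),$$ $$f_j\le g_j+C_n^j+\sum_{i=1}^{n-1}N_{i,j}C_i\qquad (1\le j\le m),$$ $$g_1=0,\qquad g_j=f_{j-1}+S_n^{j-1}\qquad (2\le j\le m).$$ If $WCRT_n\le T_n$, then this MILP has an optimal solution, and its optimal value is a safe upper bound on the worst-case response time of $\tau_n$, that is, $WCRT_n\le \max f_m$. -/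

import Mathlib

open MeasureTheory

namespace SelfSusp

/-- A uniprocessor fixed-priority task system with `p` ordinary sporadic tasks (index `0` has the
highest priority) and one lowest-priority segmented self-suspending task with `q + 1` computation
segments separated by `q` suspension intervals. -/
structure TaskSystem (p q : ℕ) where
  /-- worst-case execution times of the higher-priority tasks -/
  C : Fin p → ℝ
  /-- minimum inter-arrival times of the higher-priority tasks -/
  T : Fin p → ℝ
  /-- worst-case execution times of the computation segments of the self-suspending task -/
  Cn : Fin (q + 1) → ℝ
  /-- worst-case lengths of the suspension intervals of the self-suspending task -/
  Sn : Fin q → ℝ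
  /-- minimum inter-arrival time of the self-suspending task -/
  Tn : ℝ
  C_pos : ∀ i, 0 < C i
  T_pos : ∀ i, 0 < T i
  Cn_pos : ∀ j, 0 < Cn j
  Sn_nonneg : ∀ j, 0 ≤ Sn j
  Tn_pos : 0 < Tn

/-- What the processor can execute: job `k` of the higher-priority task `i`, or computation
segment `j` of job `k` of the self-suspending task. -/
inductive Work (p q : ℕ) where
  | hp (i : Fin p) (k : ℕ) : Work p q
  | seg (k : ℕ) (j : Fin (q + 1)) : Work p q

/-- `Higher v w`: `v` has precedence over `w`. Tasks are compared by priority, and jobs of the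
same task are served in order of release. -/
def Higher {p q : ℕ} : Work p q → Work p q → Prop
  | .hp i k, .hp i' k' => i < i' ∨ (i = i' ∧ k < k')
  | .hp _ _, .seg _ _ => True
  | .seg _ _, .hp _ _ => False
  | .seg k j, .seg k' j' => k < k' ∨ (k = k' ∧ j < j')

/-- A valid release pattern: release times that respect the minimum inter-arrival times, and
actual execution and suspension times that do not exceed the worst-case ones. -/
structure Pattern {p q : ℕ} (sys : TaskSystem p q) where
  /-- release time of job `k` of the higher-priority task `i` -/
  rel : Fin p → ℕ → ℝ
  /-- actual execution time of job `k` of the higher-priority task `i` -/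
  exec : Fin p → ℕ → ℝ
  /-- release time of job `k` of the self-suspending task -/
  relN : ℕ → ℝ
  /-- actual execution time of segment `j` of job `k` of the self-suspending task -/
  execN : ℕ → Fin (q + 1) → ℝ
  /-- actual length of suspension interval `j` of job `k` of the self-suspending task -/
  susp : ℕ → Fin q → ℝ
  rel_sep : ∀ i k, rel i k + sys.T i ≤ rel i (k + 1)
  relN_sep : ∀ k, relN k + sys.Tn ≤ relN (k + 1)
  exec_nonneg : ∀ i k, 0 ≤ exec i k
  exec_le : ∀ i k, exec i k ≤ sys.C i
  execN_nonneg : ∀ k j, 0 ≤ execN k j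
  execN_le : ∀ k j, execN k j ≤ sys.Cn j
  susp_nonneg : ∀ k j, 0 ≤ susp k j
  susp_le : ∀ k j, susp k j ≤ sys.Sn j

/-- The amount of processor time given to `w` before time `t` in the schedule `σ`, where `σ s` is
what is executed at time `s` (`none` if the processor idles). -/
noncomputable def service {p q : ℕ} (σ : ℝ → Option (Work p q)) (w : Work p q) (t : ℝ) :
    ENNReal :=
  volume {s : ℝ | s < t ∧ σ s = some w}

/-- Finishing time of `w` when it arrives at time `a` and needs execution time `c`: the first
time, from `a` on, by which `w` has received `c` units of processor time (`⊤` if there is none). -/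
noncomputable def finishFrom {p q : ℕ} (σ : ℝ → Option (Work p q)) (w : Work p q)
    (a : EReal) (c : ℝ) : EReal :=
  sInf {x : EReal | ∃ t : ℝ, x = (t : EReal) ∧ a ≤ (t : EReal) ∧
    ENNReal.ofReal c ≤ service σ w t}

namespace Pattern

variable {p q : ℕ} {sys : TaskSystem p q}

/-- Arrival time of segment `j` of job `k` of the self-suspending task: the first segment arrives
with the job, and each later one when the suspension after the previous segment ends. -/
noncomputable def segArrival (P : Pattern sys) (σ : ℝ → Option (Work p q)) (k : ℕ)
    (j : Fin (q + 1)) : EReal :=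
  Fin.induction (motive := fun _ => EReal) (P.relN k : EReal)
    (fun l a => finishFrom σ (.seg k l.castSucc) a (P.execN k l.castSucc) + (P.susp k l : EReal)) j

/-- Finishing time of segment `j` of job `k` of the self-suspending task. -/
noncomputable def segFinish (P : Pattern sys) (σ : ℝ → Option (Work p q)) (k : ℕ)
    (j : Fin (q + 1)) : EReal :=
  finishFrom σ (.seg k j) (P.segArrival σ k j) (P.execN k j)

/-- Time at which `w` becomes ready for execution. -/
noncomputable def arrival (P : Pattern sys) (σ : ℝ → Option (Work p q)) : Work p q → EReal
  | .hp i k => (P.rel i k : EReal)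
  | .seg k j => P.segArrival σ k j

/-- Actual execution time of `w`. -/
def demand (P : Pattern sys) : Work p q → ℝ
  | .hp i k => P.exec i k
  | .seg k j => P.execN k j

/-- `w` is ready at time `t` and not yet finished. -/
def Pending (P : Pattern sys) (σ : ℝ → Option (Work p q)) (w : Work p q) (t : ℝ) : Prop :=
  P.arrival σ w ≤ (t : EReal) ∧ service σ w t < ENNReal.ofReal (P.demand w)

/-- `σ` is the fixed-priority preemptive schedule of the pattern `P`: at each time the processor
executes the pending work of highest precedence, and idles only if nothing is pending. -/
structure IsFPSchedule (P : Pattern sys) (σ : ℝ → Option (Work p q)) : Prop where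
  measurable : ∀ w, MeasurableSet {t : ℝ | σ t = some w}
  highest : ∀ t w, σ t = some w → P.Pending σ w t ∧ ∀ v, P.Pending σ v t → ¬ Higher v w
  idle : ∀ t, σ t = none → ∀ v, ¬ P.Pending σ v t

/-- Response time of job `k` of the self-suspending task (`⊤` if it never finishes). -/
noncomputable def response (P : Pattern sys) (σ : ℝ → Option (Work p q)) (k : ℕ) : EReal :=
  P.segFinish σ k (Fin.last q) - (P.relN k : EReal)

end Pattern

/-- Worst-case response time of the self-suspending task: the least upper bound of the response
times of all its jobs, over all valid release patterns. -/
noncomputable def TaskSystem.wcrt {p q : ℕ} (sys : TaskSystem p q) : EReal :=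
  sSup {x : EReal | ∃ (P : Pattern sys) (σ : ℝ → Option (Work p q)), P.IsFPSchedule σ ∧
    ∃ k : ℕ, x = P.response σ k}

/-- The constraints of the mixed-integer linear program. -/
structure TaskSystem.MILPFeasible {p q : ℕ} (sys : TaskSystem p q) (g f : Fin (q + 1) → ℝ)
    (r : Fin p → Fin (q + 1) → ℝ) (N : Fin p → Fin (q + 1) → ℤ) : Prop where
  r_ge : ∀ i j, g j ≤ r i j
  N_nonneg : ∀ i j, 0 ≤ N i j
  N_le_ceil : ∀ i j, N i j ≤ ⌈(f j - r i j) / sys.T i⌉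
  N_le_dist : ∀ i (j : Fin q), (N i j.castSucc : ℝ) ≤ (r i j.succ - r i j.castSucc) / sys.T i
  f_le : ∀ j, f j ≤ g j + sys.Cn j + ∑ i, (N i j : ℝ) * sys.C i
  g_zero : g 0 = 0
  g_succ : ∀ j : Fin q, g j.succ = f j.castSucc + sys.Sn j

/-- The values of the objective (the finishing time of the last segment) over all feasible
solutions of the mixed-integer linear program. -/
def TaskSystem.milpValues {p q : ℕ} (sys : TaskSystem p q) : Set ℝ :=
  {v : ℝ | ∃ (g f : Fin (q + 1) → ℝ) (r : Fin p → Fin (q + 1) → ℝ)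
    (N : Fin p → Fin (q + 1) → ℤ), sys.MILPFeasible g f r N ∧ v = f (Fin.last q)}

end SelfSusp

/-! Fix a job of the suspending task in a schedule. Let b_j be the last instant, up to the arrival
of segment j, at which no earlier released higher-priority job is incomplete (`busyStart`). Let f_j
be the finishing time of segment j, cut at b_{j+1} unless j is last. Since every job of the
suspending task finishes before the next one is released, the processor serves in (b_j, f_j), up to
a null set, only segment j and higher-priority jobs released in [b_j, f_j). Hence the length is at
most the demand (`sub_le_load`). The numbers of these releases, with r chosen as early as separation
allows (`firstRel`), satisfy the program except that the start is arbitrary and the equalities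
g_{j+1} = f_j + S_j become inequalities (`Relaxed`). Making all lengths tight restores the
equalities without shortening the total (`Relaxed.feasible`), so the response time is at most a
value of the program.

An optimum exists when the higher-priority utilization is below one: the ceilings then bound N, and
for each of the finitely many N the tight starting times are best. A utilization of at least one
contradicts the hypothesis, because synchronous periodic releases would keep the first segment
waiting beyond Tn. The worst case ranges over actual schedules, so a schedule for those releases has
to be constructed (`exists_schedule`). -/

namespace SelfSusp

/-! ### The linear program: relaxation, tightening and existence of an optimum. -/

namespace TaskSystem

variable {p q : ℕ} (sys : TaskSystem p q)

/-- Length of computation segment `j` together with the interference counted by `N`. -/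
noncomputable def load (N : Fin p → Fin (q + 1) → ℤ) (j : Fin (q + 1)) : ℝ :=
  sys.Cn j + ∑ i, (N i j : ℝ) * sys.C i

/-- The starting times of the segments when every constraint on them is tight. -/
noncomputable def tightStart (N : Fin p → Fin (q + 1) → ℤ) (j : Fin (q + 1)) : ℝ :=
  Fin.induction (motive := fun _ => ℝ) 0
    (fun l g => g + sys.load N l.castSucc + sys.Sn l) j

theorem tightStart_zero (N : Fin p → Fin (q + 1) → ℤ) : sys.tightStart N 0 = 0 := rfl

theorem tightStart_succ (N : Fin p → Fin (q + 1) → ℤ) (l : Fin q) :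
    sys.tightStart N l.succ =
      sys.tightStart N l.castSucc + sys.load N l.castSucc + sys.Sn l := by
  simp [tightStart, Fin.induction_succ]

/-- A solution of the linear program in which the segments may be shorter, and the suspensions
shorter, than the tight ones. -/
structure Relaxed (b f : Fin (q + 1) → ℝ) (r : Fin p → Fin (q + 1) → ℝ)
    (N : Fin p → Fin (q + 1) → ℤ) : Prop where
  r_ge : ∀ i j, b j ≤ r i j
  N_nonneg : ∀ i j, 0 ≤ N i j
  N_le_ceil : ∀ i j, N i j ≤ ⌈(f j - r i j) / sys.T i⌉
  N_le_dist : ∀ i (j : Fin q), (N i j.castSucc : ℝ) ≤ (r i j.succ - r i j.castSucc) / sys.T i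
  f_le : ∀ j, f j ≤ b j + sys.load N j
  b_succ : ∀ j : Fin q, b j.succ ≤ f j.castSucc + sys.Sn j

variable {sys}

theorem MILPFeasible.relaxed {g f : Fin (q + 1) → ℝ} {r : Fin p → Fin (q + 1) → ℝ}
    {N : Fin p → Fin (q + 1) → ℤ} (h : sys.MILPFeasible g f r N) : sys.Relaxed g f r N where
  r_ge := h.r_ge
  N_nonneg := h.N_nonneg
  N_le_ceil := h.N_le_ceil
  N_le_dist := h.N_le_dist
  f_le j := by rw [load, ← add_assoc]; exact h.f_le j
  b_succ j := (h.g_succ j).le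

theorem Relaxed.sub_le_tightStart {b f : Fin (q + 1) → ℝ} {r : Fin p → Fin (q + 1) → ℝ}
    {N : Fin p → Fin (q + 1) → ℤ} (h : sys.Relaxed b f r N) (j : Fin (q + 1)) :
    b j - b 0 ≤ sys.tightStart N j := by
  induction j using Fin.induction with
  | zero => simp [tightStart_zero]
  | succ l ih =>
    rw [tightStart_succ]
    linarith [h.f_le l.castSucc, h.b_succ l]

/-- Stretching a relaxed solution gives a solution of the linear program. -/
theorem Relaxed.feasible {b f : Fin (q + 1) → ℝ} {r : Fin p → Fin (q + 1) → ℝ}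
    {N : Fin p → Fin (q + 1) → ℤ} (h : sys.Relaxed b f r N) :
    sys.MILPFeasible (sys.tightStart N) (fun j => sys.tightStart N j + sys.load N j)
      (fun i j => sys.tightStart N j + (r i j - b j)) N where
  r_ge i j := by linarith [h.r_ge i j]
  N_nonneg := h.N_nonneg
  -- Each `r` keeps its offset from the start of its segment while segments and suspensions only
  -- lengthen, so `f - r` and the gaps of `r` can only grow.
  N_le_ceil i j := (h.N_le_ceil i j).trans <| Int.ceil_mono <|
    div_le_div_of_nonneg_right (by linarith [h.f_le j]) (sys.T_pos i).le
  N_le_dist i j := (h.N_le_dist i j).trans <| div_le_div_of_nonneg_right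
    (by rw [tightStart_succ]; linarith [h.f_le j.castSucc, h.b_succ j]) (sys.T_pos i).le
  f_le j := by simp only [load]; linarith
  g_zero := rfl
  g_succ j := sys.tightStart_succ N j

theorem Relaxed.exists_milpValue {b f : Fin (q + 1) → ℝ} {r : Fin p → Fin (q + 1) → ℝ}
    {N : Fin p → Fin (q + 1) → ℤ} (h : sys.Relaxed b f r N) :
    ∃ v ∈ sys.milpValues, f (Fin.last q) - b 0 ≤ v :=
  ⟨_, ⟨_, _, _, _, h.feasible, rfl⟩, by
    linarith [h.f_le (Fin.last q), h.sub_le_tightStart (Fin.last q)]⟩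

theorem relaxed_zero (sys : TaskSystem p q) : sys.Relaxed 0 0 0 0 where
  r_ge _ _ := le_rfl
  N_nonneg _ _ := le_rfl
  N_le_ceil _ _ := by simp
  N_le_dist _ _ := by simp
  f_le j := by simpa [load] using (sys.Cn_pos j).le
  b_succ j := by simpa using sys.Sn_nonneg j

/-- With x = f_j - g_j and utilization U, the ceilings give N ≤ x / T + 1. Inserted into the
constraint on f_j, this yields x (1 - U) ≤ Cn_j + ∑ C_i, which bounds x and then N. -/
theorem MILPFeasible.N_le {g f : Fin (q + 1) → ℝ} {r : Fin p → Fin (q + 1) → ℝ}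
    {N : Fin p → Fin (q + 1) → ℤ} (h : sys.MILPFeasible g f r N)
    (hU : ∑ i, sys.C i / sys.T i < 1) (i : Fin p) (j : Fin (q + 1)) :
    (N i j : ℝ) ≤
      ((sys.Cn j + ∑ i, sys.C i) / (1 - ∑ i, sys.C i / sys.T i)) / sys.T i + 1 := by
  have hN : ∀ i, (N i j : ℝ) ≤ (f j - g j) / sys.T i + 1 := fun i => by
    have h1 : (N i j : ℝ) ≤ (⌈(f j - r i j) / sys.T i⌉ : ℝ) := by exact_mod_cast h.N_le_ceil i j
    have h2 := Int.ceil_lt_add_one ((f j - r i j) / sys.T i)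
    have h3 : (f j - r i j) / sys.T i ≤ (f j - g j) / sys.T i :=
      div_le_div_of_nonneg_right (by linarith [h.r_ge i j]) (sys.T_pos i).le
    linarith
  have hlen : f j - g j ≤ (sys.Cn j + ∑ i, sys.C i) / (1 - ∑ i, sys.C i / sys.T i) := by
    rw [le_div_iff₀ (by linarith)]
    have : ∑ i, (N i j : ℝ) * sys.C i ≤
        (f j - g j) * ∑ i, sys.C i / sys.T i + ∑ i, sys.C i := by
      rw [Finset.mul_sum, ← Finset.sum_add_distrib]
      refine Finset.sum_le_sum fun i _ => ?_
      have := mul_le_mul_of_nonneg_right (hN i) (sys.C_pos i).le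
      calc _ ≤ _ := this
        _ = _ := by ring
    linarith [h.f_le j]
  exact (hN i).trans (by gcongr; exact (sys.T_pos i).le)

/-- If the higher-priority utilization is below one, then the linear program has an optimal
solution. -/
theorem exists_isGreatest_milpValues (sys : TaskSystem p q)
    (hU : ∑ i, sys.C i / sys.T i < 1) : ∃ V, IsGreatest sys.milpValues V := by
  let S : Set (Fin p → Fin (q + 1) → ℤ) := {N | ∃ g f r, sys.MILPFeasible g f r N}
  have hS : S.Finite := by
    refine (Set.finite_Icc (0 : Fin p → Fin (q + 1) → ℤ) (fun i j =>
      ⌈((sys.Cn j + ∑ i, sys.C i) / (1 - ∑ i, sys.C i / sys.T i)) / sys.T i + 1⌉)).subset ?_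
    rintro N ⟨g, f, r, h⟩
    refine ⟨h.N_nonneg, fun i j => ?_⟩
    have := (h.N_le hU i j).trans (Int.le_ceil _)
    exact_mod_cast this
  have hne : S.Nonempty := ⟨0, _, _, _, sys.relaxed_zero.feasible⟩
  obtain ⟨N, ⟨g, f, r, hN⟩, hmax⟩ := hS.exists_maximalFor
    (fun N => sys.tightStart N (Fin.last q) + sys.load N (Fin.last q)) S hne
  refine ⟨_, ⟨_, _, _, _, hN.relaxed.feasible, rfl⟩, ?_⟩
  rintro _ ⟨g', f', r', N', h', rfl⟩
  have h1 := h'.relaxed.sub_le_tightStart (Fin.last q)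
  have h2 := h'.relaxed.f_le (Fin.last q)
  have h3 : sys.tightStart N' (Fin.last q) + sys.load N' (Fin.last q) ≤
      sys.tightStart N (Fin.last q) + sys.load N (Fin.last q) := by
    by_contra! hlt
    exact absurd (hmax ⟨g', f', r', h'⟩ hlt.le) (not_le.2 hlt)
  rw [h'.g_zero] at h1
  linarith

end TaskSystem

/-! ### Service, arrival and finishing times in a schedule. -/

variable {p q : ℕ}

theorem volume_inter_Iio_le_add (F : Set ℝ) {x c : ℝ} :
    volume (F ∩ Set.Iio c) ≤ volume (F ∩ Set.Iio x) + ENNReal.ofReal (c - x) := by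
  rw [← Real.volume_Ico]
  refine (measure_mono ?_).trans (measure_union_le _ _)
  intro s hs
  rcases lt_or_ge s x with h | h
  · exact Or.inl ⟨hs.1, h⟩
  · exact Or.inr ⟨h, hs.2⟩

/-- A set that stops growing once it has measure `d` has measure at most `d`. -/
theorem volume_inter_Iio_le {A : Set ℝ} {d : ENNReal}
    (h : ∀ s ∈ A, volume (A ∩ Set.Iio s) < d) (t : ℝ) : volume (A ∩ Set.Iio t) ≤ d := by
  rcases (A ∩ Set.Iio t).eq_empty_or_nonempty with he | hne
  · simp [he]
  have hbdd : BddAbove (A ∩ Set.Iio t) := ⟨t, fun s hs => hs.2.le⟩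
  refine ENNReal.le_of_forall_pos_le_add fun ε hε _ => ?_
  have hε' : (0 : ℝ) < ε := hε
  -- The part of the set beyond a point within `ε` of its supremum has measure at most `ε`.
  obtain ⟨s, hs, hlt⟩ := exists_lt_of_lt_csSup hne
    (show sSup (A ∩ Set.Iio t) - ε < sSup (A ∩ Set.Iio t) by linarith)
  calc volume (A ∩ Set.Iio t)
      ≤ volume (A ∩ Set.Iio s ∪ Set.Icc s (s + ε)) := by
        refine measure_mono fun x hx => ?_
        rcases lt_or_ge x s with h1 | h1
        · exact Or.inl ⟨hx.1, h1⟩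
        · exact Or.inr ⟨h1, by linarith [le_csSup hbdd hx]⟩
    _ ≤ volume (A ∩ Set.Iio s) + volume (Set.Icc s (s + ε)) := measure_union_le _ _
    _ ≤ d + ε := by
        rw [Real.volume_Icc, add_sub_cancel_left, ENNReal.ofReal_coe_nnreal]
        exact add_le_add_left (h s hs.1).le _

theorem service_mono (σ : ℝ → Option (Work p q)) (w : Work p q) : Monotone (service σ w) :=
  fun _ _ h => measure_mono fun _ hs => ⟨hs.1.trans_le h, hs.2⟩

theorem service_eq (σ : ℝ → Option (Work p q)) (w : Work p q) (t : ℝ) :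
    service σ w t = volume ({s | σ s = some w} ∩ Set.Iio t) := by
  rw [service]; congr 1; ext s; exact and_comm

theorem le_finishFrom (σ : ℝ → Option (Work p q)) (w : Work p q) (a : EReal) (c : ℝ) :
    a ≤ finishFrom σ w a c :=
  le_sInf fun _ ⟨_, hx, ha, _⟩ => hx ▸ ha

theorem finishFrom_le {σ : ℝ → Option (Work p q)} {w : Work p q} {a : EReal} {c t : ℝ}
    (ha : a ≤ t) (hc : ENNReal.ofReal c ≤ service σ w t) : finishFrom σ w a c ≤ t :=
  sInf_le ⟨t, rfl, ha, hc⟩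

theorem le_service_of_finishFrom_lt {σ : ℝ → Option (Work p q)} {w : Work p q} {a : EReal}
    {c t : ℝ} (h : finishFrom σ w a c < t) : ENNReal.ofReal c ≤ service σ w t := by
  obtain ⟨_, ⟨s, rfl, _, hs⟩, hlt⟩ := sInf_lt_iff.1 h
  exact hs.trans (service_mono σ w (EReal.coe_lt_coe_iff.1 hlt).le)

namespace Pattern

variable {sys : TaskSystem p q} (P : Pattern sys) (σ : ℝ → Option (Work p q))

theorem segArrival_zero (k : ℕ) : P.segArrival σ k 0 = (P.relN k : EReal) := rfl

theorem segArrival_succ (k : ℕ) (l : Fin q) :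
    P.segArrival σ k l.succ = P.segFinish σ k l.castSucc + (P.susp k l : EReal) := by
  simp [segArrival, segFinish, Fin.induction_succ]

theorem segArrival_le_segFinish (k : ℕ) (j : Fin (q + 1)) :
    P.segArrival σ k j ≤ P.segFinish σ k j := le_finishFrom _ _ _ _

theorem segFinish_le_segArrival_succ (k : ℕ) (l : Fin q) :
    P.segFinish σ k l.castSucc ≤ P.segArrival σ k l.succ := by
  rw [segArrival_succ]
  exact le_add_of_nonneg_right (EReal.coe_nonneg.2 (P.susp_nonneg k l))

theorem segArrival_mono (k : ℕ) : Monotone (P.segArrival σ k) :=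
  Fin.monotone_iff_le_succ.2 fun l =>
    (P.segArrival_le_segFinish σ k _).trans (P.segFinish_le_segArrival_succ σ k l)

theorem segFinish_mono (k : ℕ) : Monotone (P.segFinish σ k) :=
  Fin.monotone_iff_le_succ.2 fun l =>
    (P.segFinish_le_segArrival_succ σ k l).trans (P.segArrival_le_segFinish σ k _)

theorem segFinish_le_segArrival_of_lt (k : ℕ) {j j' : Fin (q + 1)} (h : j < j') :
    P.segFinish σ k j ≤ P.segArrival σ k j' := by
  obtain ⟨l, rfl⟩ := Fin.exists_castSucc_eq.2 (Fin.ne_last_of_lt h)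
  exact (P.segFinish_le_segArrival_succ σ k l).trans
    (P.segArrival_mono σ k (Fin.castSucc_lt_iff_succ_le.1 h))

theorem relN_le_segArrival (k : ℕ) (j : Fin (q + 1)) :
    (P.relN k : EReal) ≤ P.segArrival σ k j := P.segArrival_mono σ k (Fin.zero_le j)

variable {P σ}

theorem IsFPSchedule.service_le (h : P.IsFPSchedule σ) (w : Work p q) (t : ℝ) :
    service σ w t ≤ ENNReal.ofReal (P.demand w) := by
  rw [service_eq]
  refine volume_inter_Iio_le (fun s hs => ?_) t
  rw [← service_eq]
  exact (h.highest s w hs).1.2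

theorem IsFPSchedule.exists_hp (h : P.IsFPSchedule σ) {t : ℝ} {i : Fin p} {k : ℕ}
    (hp : P.Pending σ (.hp i k) t) : ∃ i' k', σ t = some (.hp i' k') := by
  rcases hw : σ t with _ | ⟨i', k'⟩ | ⟨k', j'⟩
  · exact absurd hp (h.idle t hw _)
  · exact ⟨i', k', rfl⟩
  · exact absurd trivial ((h.highest t _ hw).2 _ hp)

theorem rel_add_le (P : Pattern sys) (i : Fin p) (k n : ℕ) :
    P.rel i k + n * sys.T i ≤ P.rel i (k + n) := by
  induction n with
  | zero => simp
  | succ n ih => push_cast; rw [← add_assoc]; linarith [P.rel_sep i (k + n)]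

theorem rel_mono (P : Pattern sys) (i : Fin p) : Monotone (P.rel i) :=
  monotone_nat_of_le_succ fun k => by linarith [P.rel_sep i k, sys.T_pos i]

theorem relN_add_le_of_lt (P : Pattern sys) {k k' : ℕ} (h : k < k') :
    P.relN k + sys.Tn ≤ P.relN k' := by
  have hm : Monotone P.relN :=
    monotone_nat_of_le_succ fun k => by linarith [P.relN_sep k, sys.Tn_pos]
  exact (P.relN_sep k).trans (hm h)

theorem exists_le_rel (P : Pattern sys) (i : Fin p) (t : ℝ) : ∃ k, t ≤ P.rel i k := by
  obtain ⟨n, hn⟩ := exists_nat_ge ((t - P.rel i 0) / sys.T i)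
  rw [div_le_iff₀ (sys.T_pos i)] at hn
  have := P.rel_add_le i 0 n
  rw [zero_add] at this
  exact ⟨n, by linarith⟩

open Classical in
/-- Number of jobs of task `i` released before `t`. -/
noncomputable def count (P : Pattern sys) (i : Fin p) (t : ℝ) : ℕ :=
  Nat.find (P.exists_le_rel i t)

theorem lt_count_iff (P : Pattern sys) {i : Fin p} {t : ℝ} {k : ℕ} :
    k < P.count i t ↔ P.rel i k < t := by
  classical
  constructor
  · intro h
    exact not_le.1 (Nat.find_min _ h)
  · intro h
    by_contra! hk
    exact absurd h (not_lt.2 ((Nat.find_spec (P.exists_le_rel i t)).trans (P.rel_mono i hk)))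

theorem count_le_iff (P : Pattern sys) {i : Fin p} {t : ℝ} {k : ℕ} :
    P.count i t ≤ k ↔ t ≤ P.rel i k := by
  rw [← not_lt, lt_count_iff, not_lt]

theorem count_mono (P : Pattern sys) (i : Fin p) : Monotone (P.count i) := fun _ _ h =>
  P.count_le_iff.2 (h.trans (P.count_le_iff.1 le_rfl))

/-! ### Busy intervals and their demand. -/

/-- All higher-priority jobs released before `s` are completed at `s`. -/
def Clear (P : Pattern sys) (σ : ℝ → Option (Work p q)) (s : ℝ) : Prop :=
  ∀ i k, P.rel i k < s → ENNReal.ofReal (P.exec i k) ≤ service σ (.hp i k) s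

/-- The last time up to `a` at which no earlier released higher-priority job is incomplete. -/
noncomputable def busyStart (P : Pattern sys) (σ : ℝ → Option (Work p q)) (a : ℝ) : ℝ :=
  sSup {s | s ≤ a ∧ P.Clear σ s}

theorem clear_nonempty (P : Pattern sys) (σ : ℝ → Option (Work p q)) (a : ℝ) :
    {s | s ≤ a ∧ P.Clear σ s}.Nonempty := by
  obtain ⟨m, hm⟩ := (Set.finite_range fun i => P.rel i 0).bddBelow
  refine ⟨min a m, min_le_left _ _, fun i k hk => ?_⟩
  have h1 : m ≤ P.rel i 0 := hm ⟨i, rfl⟩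
  have h2 := P.rel_mono i (Nat.zero_le k)
  linarith [min_le_right a m]

theorem clear_bddAbove (P : Pattern sys) (σ : ℝ → Option (Work p q)) (a : ℝ) :
    BddAbove {s | s ≤ a ∧ P.Clear σ s} := ⟨a, fun _ hs => hs.1⟩

theorem busyStart_le (P : Pattern sys) (σ : ℝ → Option (Work p q)) (a : ℝ) :
    P.busyStart σ a ≤ a := csSup_le (P.clear_nonempty σ a) fun _ hs => hs.1

theorem busyStart_mono (P : Pattern sys) (σ : ℝ → Option (Work p q)) :
    Monotone (P.busyStart σ) := fun a a' h =>
  csSup_le_csSup (P.clear_bddAbove σ a') (P.clear_nonempty σ a) fun _ hs => ⟨hs.1.trans h, hs.2⟩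

/-- The supremum is attained: a job released strictly before it is also released before some clear
instant, and service is monotone. -/
theorem clear_busyStart (P : Pattern sys) (σ : ℝ → Option (Work p q)) (a : ℝ) :
    P.Clear σ (P.busyStart σ a) := fun i k hk => by
  obtain ⟨s, hs, hlt⟩ := exists_lt_of_lt_csSup (P.clear_nonempty σ a) hk
  exact (hs.2 i k hlt).trans (service_mono _ _ (le_csSup (P.clear_bddAbove σ a) hs))

theorem IsFPSchedule.exists_hp_of_busyStart_lt (h : P.IsFPSchedule σ) {a s : ℝ}
    (hs : P.busyStart σ a < s) (hsa : s ≤ a) : ∃ i k, σ s = some (.hp i k) := by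
  have : ¬ P.Clear σ s := fun hc =>
    absurd (le_csSup (P.clear_bddAbove σ a) ⟨hsa, hc⟩) (not_le.2 hs)
  simp only [Clear, not_forall, not_le] at this
  obtain ⟨i, k, hk, hlt⟩ := this
  exact h.exists_hp ⟨EReal.coe_le_coe_iff.2 hk.le, hlt⟩

/-- A segment whose earlier segments and jobs finish in time suffers only interference from
higher-priority jobs. -/
theorem IsFPSchedule.hp_or_seg (h : P.IsFPSchedule σ)
    (hfin : ∀ k, P.segFinish σ k (Fin.last q) ≤ ((P.relN k + sys.Tn : ℝ) : EReal))
    {k : ℕ} {j : Fin (q + 1)} {s : ℝ} (has : P.segArrival σ k j < s)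
    (hsf : (s : EReal) < P.segFinish σ k j) :
    (∃ i' k', σ s = some (.hp i' k')) ∨ σ s = some (.seg k j) := by
  have hpend : P.Pending σ (.seg k j) s :=
    ⟨has.le, not_le.1 fun hle => absurd (finishFrom_le has.le hle) (not_le.2 hsf)⟩
  rcases hw : σ s with _ | ⟨i', k'⟩ | ⟨k', j'⟩
  · exact absurd hpend (h.idle s hw _)
  · exact Or.inl ⟨i', k', rfl⟩
  · right
    obtain ⟨⟨_, hlt⟩, hno⟩ := h.highest s _ hw
    have hno := hno _ hpend
    have hdone : P.segFinish σ k' j' ≤ P.segArrival σ k j → False := fun hle =>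
      absurd (le_service_of_finishFrom_lt (hle.trans_lt has)) (not_le.2 hlt)
    simp only [Higher, not_or, not_lt, not_and] at hno
    rcases lt_or_eq_of_le hno.1 with hk | rfl
    · refine (hdone ?_).elim
      calc P.segFinish σ k' j' ≤ P.segFinish σ k' (Fin.last q) :=
            P.segFinish_mono σ k' (Fin.le_last _)
        _ ≤ _ := hfin k'
        _ ≤ (P.relN k : EReal) := EReal.coe_le_coe_iff.2 (P.relN_add_le_of_lt hk)
        _ ≤ _ := P.relN_le_segArrival σ k j
    · rcases lt_or_eq_of_le (hno.2 rfl) with hj | rfl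
      · exact (hdone (P.segFinish_le_segArrival_of_lt σ _ hj)).elim
      · rfl

/-- The length of a busy interval that serves one segment is bounded by the demand of the
segment and of the higher-priority jobs released in the interval. -/
theorem IsFPSchedule.sub_le_load (h : P.IsFPSchedule σ)
    (hfin : ∀ k, P.segFinish σ k (Fin.last q) ≤ ((P.relN k + sys.Tn : ℝ) : EReal))
    {k : ℕ} {j : Fin (q + 1)} {a e : ℝ} (ha : P.segArrival σ k j = a)
    (he : (e : EReal) ≤ P.segFinish σ k j) (hbe : P.busyStart σ a ≤ e) :
    e - P.busyStart σ a ≤ sys.Cn j +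
      ∑ i, ((P.count i e : ℝ) - P.count i (P.busyStart σ a)) * sys.C i := by
  set b := P.busyStart σ a with hb
  have hcover : Set.Ioo b e \ {a} ⊆ (⋃ i ∈ (Finset.univ : Finset (Fin p)),
      ⋃ n ∈ Finset.Ico (P.count i b) (P.count i e), {s | s < e ∧ σ s = some (.hp i n)}) ∪
      {s | s < e ∧ σ s = some (.seg k j)} := by
    rintro s ⟨⟨hbs, hse⟩, hsa⟩
    have hs : (∃ i' k', σ s = some (.hp i' k')) ∨ σ s = some (.seg k j) := by
      rcases lt_or_gt_of_ne (show s ≠ a from hsa) with hlt | hgt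
      · exact Or.inl (h.exists_hp_of_busyStart_lt hbs hlt.le)
      · exact h.hp_or_seg hfin (ha ▸ EReal.coe_lt_coe_iff.2 hgt)
          ((EReal.coe_lt_coe_iff.2 hse).trans_le he)
    rcases hs with ⟨i, n, hs⟩ | hs
    · left
      obtain ⟨⟨harr, hlt⟩, _⟩ := h.highest s _ hs
      simp only [Set.mem_iUnion]
      refine ⟨i, Finset.mem_univ _, n, Finset.mem_Ico.2 ⟨?_, ?_⟩, hse, hs⟩
      · by_contra! hn
        have := P.clear_busyStart σ a i n (P.lt_count_iff.1 hn)
        exact absurd (this.trans (service_mono _ _ hbs.le)) (not_le.2 hlt)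
      · exact P.lt_count_iff.2 ((EReal.coe_le_coe_iff.1 harr).trans_lt hse)
    · exact Or.inr ⟨hse, hs⟩
  have hvol : ENNReal.ofReal (e - b) ≤
      (∑ i, ∑ n ∈ Finset.Ico (P.count i b) (P.count i e), ENNReal.ofReal (sys.C i)) +
        ENNReal.ofReal (sys.Cn j) := by
    calc ENNReal.ofReal (e - b) = volume (Set.Ioo b e \ {a}) := by
          rw [measure_sdiff_null (by simp), Real.volume_Ioo]
      _ ≤ _ := measure_mono hcover
      _ ≤ _ := measure_union_le _ _
      _ ≤ _ := by
        refine add_le_add ((measure_biUnion_finset_le _ _).trans (Finset.sum_le_sum fun i _ =>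
          (measure_biUnion_finset_le _ _).trans (Finset.sum_le_sum fun n _ => ?_))) ?_
        · exact (h.service_le (.hp i n) e).trans (ENNReal.ofReal_le_ofReal (P.exec_le i n))
        · exact (h.service_le (.seg k j) e).trans (ENNReal.ofReal_le_ofReal (P.execN_le k j))
  have hsum : (∑ i, ∑ n ∈ Finset.Ico (P.count i b) (P.count i e), ENNReal.ofReal (sys.C i)) =
      ENNReal.ofReal (∑ i, ((P.count i e : ℝ) - P.count i b) * sys.C i) := by
    rw [ENNReal.ofReal_sum_of_nonneg]
    · refine Finset.sum_congr rfl fun i _ => ?_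
      rw [← ENNReal.ofReal_sum_of_nonneg fun _ _ => (sys.C_pos i).le, Finset.sum_const,
        Nat.card_Ico, nsmul_eq_mul, Nat.cast_sub (P.count_mono i hbe)]
    · intro i _
      exact mul_nonneg (sub_nonneg.2 (Nat.cast_le.2 (P.count_mono i hbe))) (sys.C_pos i).le
  have hnn : 0 ≤ ∑ i, ((P.count i e : ℝ) - P.count i b) * sys.C i :=
    Finset.sum_nonneg fun i _ =>
      mul_nonneg (sub_nonneg.2 (Nat.cast_le.2 (P.count_mono i hbe))) (sys.C_pos i).le
  rw [hsum, ← ENNReal.ofReal_add hnn (sys.Cn_pos j).le,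
    ENNReal.ofReal_le_ofReal_iff (add_nonneg hnn (sys.Cn_pos j).le)] at hvol
  linarith

/-! ### From a schedule to a relaxed solution. -/

/-- Earliest times at which the releases counted in the intervals `[b j, f j)` may start. -/
noncomputable def firstRel (P : Pattern sys) (b f : Fin (q + 1) → ℝ) (i : Fin p)
    (j : Fin (q + 1)) : ℝ :=
  Fin.induction (motive := fun _ => ℝ) (b 0) (fun l r => max (b l.succ)
    (r + ((P.count i (f l.castSucc) : ℝ) - P.count i (b l.castSucc)) * sys.T i)) j

theorem firstRel_zero (P : Pattern sys) (b f : Fin (q + 1) → ℝ) (i : Fin p) :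
    P.firstRel b f i 0 = b 0 := rfl

theorem firstRel_succ (P : Pattern sys) (b f : Fin (q + 1) → ℝ) (i : Fin p) (l : Fin q) :
    P.firstRel b f i l.succ = max (b l.succ) (P.firstRel b f i l.castSucc +
      ((P.count i (f l.castSucc) : ℝ) - P.count i (b l.castSucc)) * sys.T i) := by
  simp [firstRel, Fin.induction_succ]

theorem le_firstRel (P : Pattern sys) (b f : Fin (q + 1) → ℝ) (i : Fin p) (j : Fin (q + 1)) :
    b j ≤ P.firstRel b f i j := by
  cases j using Fin.cases with
  | zero => exact le_rfl
  | succ l => rw [firstRel_succ]; exact le_max_left _ _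

variable {b f : Fin (q + 1) → ℝ}

/-- A release after interval l lies at least N periods after the first release from `b l` on, where
N counts the releases in that interval; the induction applies to that first release. -/
theorem firstRel_le_rel (P : Pattern sys) (hbf : ∀ j, b j ≤ f j)
    (hfb : ∀ l : Fin q, f l.castSucc ≤ b l.succ) (i : Fin p) (j : Fin (q + 1)) (k : ℕ)
    (hk : b j ≤ P.rel i k) : P.firstRel b f i j ≤ P.rel i k := by
  induction j using Fin.induction generalizing k with
  | zero => exact hk
  | succ l ih =>
    rw [firstRel_succ]
    refine max_le hk ?_
    have h1 := ih _ (P.count_le_iff.1 le_rfl)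
    have hle := P.count_mono i (hbf l.castSucc)
    have h2 := P.rel_add_le i (P.count i (b l.castSucc))
      (P.count i (f l.castSucc) - P.count i (b l.castSucc))
    rw [Nat.cast_sub hle, Nat.add_sub_cancel' hle] at h2
    have h3 := P.rel_mono i (P.count_le_iff.2 ((hfb l).trans hk))
    linarith

theorem count_sub_lt_of_lt (P : Pattern sys) (hbf : ∀ j, b j ≤ f j)
    (hfb : ∀ l : Fin q, f l.castSucc ≤ b l.succ) {i : Fin p} {j : Fin (q + 1)}
    (hlt : P.count i (b j) < P.count i (f j)) :
    ((P.count i (f j) : ℝ) - P.count i (b j) - 1) * sys.T i < f j - P.firstRel b f i j := by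
  have h1 := P.firstRel_le_rel hbf hfb i j _ (P.count_le_iff.1 le_rfl)
  obtain ⟨n, hn⟩ := Nat.exists_eq_add_of_lt hlt
  have h2 := P.rel_add_le i (P.count i (b j)) n
  have h3 : P.rel i (P.count i (b j) + n) < f j := P.lt_count_iff.1 (by omega)
  have h4 : (P.count i (f j) : ℝ) = P.count i (b j) + n + 1 := by exact_mod_cast hn
  rw [h4, show (P.count i (b j) : ℝ) + n + 1 - P.count i (b j) - 1 = n by ring]
  linarith

/-- This is the ceiling constraint. For an interval without releases it says r < f + T, which is
inherited: r is either b or the previous r plus N periods, and the latter is below the previous f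
plus T by induction. -/
theorem count_sub_lt (P : Pattern sys) (hbf : ∀ j, b j ≤ f j)
    (hfb : ∀ l : Fin q, f l.castSucc ≤ b l.succ) (i : Fin p) (j : Fin (q + 1)) :
    ((P.count i (f j) : ℝ) - P.count i (b j) - 1) * sys.T i < f j - P.firstRel b f i j := by
  have hT := sys.T_pos i
  induction j using Fin.induction with
  | zero =>
    rcases (P.count_mono i (hbf 0)).lt_or_eq with hlt | heq
    · exact P.count_sub_lt_of_lt hbf hfb hlt
    · rw [firstRel_zero, heq]; linarith [hbf 0]
  | succ l ih =>
    rcases (P.count_mono i (hbf l.succ)).lt_or_eq with hlt | heq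
    · exact P.count_sub_lt_of_lt hbf hfb hlt
    · rw [heq]
      have : P.firstRel b f i l.succ < f l.succ + sys.T i := by
        rw [firstRel_succ]
        exact max_lt (by linarith [hbf l.succ]) (by linarith [hbf l.succ, hfb l])
      linarith

/-- The releases counted in consecutive intervals give a relaxed solution of the program. -/
theorem relaxed (P : Pattern sys) (hbf : ∀ j, b j ≤ f j)
    (hfb : ∀ l : Fin q, f l.castSucc ≤ b l.succ)
    (hload : ∀ j, f j - b j ≤ sys.Cn j + ∑ i, ((P.count i (f j) : ℝ) - P.count i (b j)) * sys.C i)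
    (hsusp : ∀ l : Fin q, b l.succ ≤ f l.castSucc + sys.Sn l) :
    sys.Relaxed b f (P.firstRel b f)
      (fun i j => (P.count i (f j) : ℤ) - P.count i (b j)) where
  r_ge i j := P.le_firstRel b f i j
  N_nonneg i j := by simpa using P.count_mono i (hbf j)
  N_le_ceil i j := by
    rw [Int.le_ceil_iff, lt_div_iff₀ (sys.T_pos i)]
    push_cast
    exact P.count_sub_lt hbf hfb i j
  N_le_dist i l := by
    rw [le_div_iff₀ (sys.T_pos i), firstRel_succ]
    push_cast
    linarith [le_max_right (b l.succ) (P.firstRel b f i l.castSucc +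
      ((P.count i (f l.castSucc) : ℝ) - P.count i (b l.castSucc)) * sys.T i)]
  f_le j := by
    simp only [TaskSystem.load]
    push_cast
    linarith [hload j]
  b_succ := hsusp

/-- If all jobs of the self-suspending task finish within `Tn`, then every response time is
bounded by a value of the linear program. -/
theorem IsFPSchedule.exists_milpValue (h : P.IsFPSchedule σ)
    (hfin : ∀ k, P.segFinish σ k (Fin.last q) ≤ ((P.relN k + sys.Tn : ℝ) : EReal)) (k : ℕ) :
    ∃ v ∈ sys.milpValues, P.response σ k ≤ (v : EReal) := by
  have hF : ∀ j, ((P.segFinish σ k j).toReal : EReal) = P.segFinish σ k j := fun j =>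
    EReal.coe_toReal
      (((P.segFinish_mono σ k (Fin.le_last j)).trans (hfin k)).trans_lt (EReal.coe_lt_top _)).ne
      ((EReal.bot_lt_coe _).trans_le
        ((P.relN_le_segArrival σ k j).trans (P.segArrival_le_segFinish σ k j))).ne'
  have hA : ∀ j, ((P.segArrival σ k j).toReal : EReal) = P.segArrival σ k j := fun j =>
    EReal.coe_toReal
      (((P.segArrival_le_segFinish σ k j).trans (hF j).ge).trans_lt (EReal.coe_lt_top _)).ne
      ((EReal.bot_lt_coe _).trans_le (P.relN_le_segArrival σ k j)).ne'
  set F : Fin (q + 1) → ℝ := fun j => (P.segFinish σ k j).toReal with hFdef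
  set a : Fin (q + 1) → ℝ := fun j => (P.segArrival σ k j).toReal with hadef
  have haF : ∀ j, a j ≤ F j := fun j => by
    rw [← EReal.coe_le_coe_iff, hF, hA]; exact P.segArrival_le_segFinish σ k j
  have hsucc : ∀ l : Fin q, a l.succ = F l.castSucc + P.susp k l := fun l => by
    rw [← EReal.coe_eq_coe_iff, EReal.coe_add, hF, hA, segArrival_succ]
  have hmono : Monotone a := Fin.monotone_iff_le_succ.2 fun l => by
    linarith [haF l.castSucc, hsucc l, P.susp_nonneg k l]
  set b : Fin (q + 1) → ℝ := fun j => P.busyStart σ (a j) with hb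
  have hbm : Monotone b := (P.busyStart_mono σ).comp hmono
  have hba : ∀ j, b j ≤ a j := fun j => P.busyStart_le σ _
  -- A segment with actual execution time zero finishes on arrival even amid higher-priority work,
  -- so the next busy interval may start before `F`; the minimum keeps the intervals from
  -- overlapping.
  set f : Fin (q + 1) → ℝ := Fin.lastCases (motive := fun _ => ℝ) (F (Fin.last q))
    (fun l => min (F l.castSucc) (b l.succ)) with hf
  have hflast : f (Fin.last q) = F (Fin.last q) := by simp [hf]
  have hfcast : ∀ l : Fin q, f l.castSucc = min (F l.castSucc) (b l.succ) := by simp [hf]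
  have hfF : ∀ j, f j ≤ F j := fun j => by
    cases j using Fin.lastCases with
    | last => exact hflast.le
    | cast l => rw [hfcast]; exact min_le_left _ _
  have hbf : ∀ j, b j ≤ f j := fun j => by
    cases j using Fin.lastCases with
    | last => rw [hflast]; exact (hba _).trans (haF _)
    | cast l =>
      rw [hfcast]
      exact le_min ((hba _).trans (haF _)) (hbm (Fin.castSucc_lt_succ).le)
  have hrel := P.relaxed hbf (fun l => by rw [hfcast]; exact min_le_right _ _)
    (fun j => h.sub_le_load hfin (hA j).symm
      ((EReal.coe_le_coe_iff.2 (hfF j)).trans (hF j).le) (hbf j))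
    (fun l => by
      rw [hfcast]
      rcases le_total (F l.castSucc) (b l.succ) with hle | hle
      · rw [min_eq_left hle]; linarith [hba l.succ, hsucc l, P.susp_le k l]
      · rw [min_eq_right hle]; linarith [sys.Sn_nonneg l])
  obtain ⟨v, hv, hle⟩ := hrel.exists_milpValue
  refine ⟨v, hv, ?_⟩
  have ha0 : a 0 = P.relN k := by simp [hadef, segArrival_zero]
  rw [response, ← hF, ← EReal.coe_sub, EReal.coe_le_coe_iff]
  have h1 := hba 0
  have h2 : F (Fin.last q) = f (Fin.last q) := hflast.symm
  simp only [hFdef] at h2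
  linarith

end Pattern

/-! ### Construction of a priority schedule. -/

/-- Here `F` is the available time and its truncation the time actually used. The measure of `F`
before t is continuous in t, so truncating when it reaches `d` loses nothing below `d`. -/
theorem volume_inter_Iio_lt_iff {F : Set ℝ} {a : ℝ} (hF : F ⊆ Set.Ici a) (d : ENNReal) (t : ℝ) :
    volume ({s | s ∈ F ∧ volume (F ∩ Set.Iio s) < d} ∩ Set.Iio t) < d ↔
      volume (F ∩ Set.Iio t) < d := by
  refine ⟨fun h => ?_, fun h => (measure_mono ?_).trans_lt h⟩
  · by_contra! hd
    refine absurd h (not_lt.2 ?_)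
    set L : Set ℝ := {x | x ≤ t ∧ volume (F ∩ Set.Iio x) < d} with hL
    by_cases hne : L.Nonempty
    · have hbdd : BddAbove L := ⟨t, fun x hx => hx.1⟩
      have hlow : ∀ s, s < sSup L → volume (F ∩ Set.Iio s) < d := fun s hs => by
        obtain ⟨x, hx, hsx⟩ := exists_lt_of_lt_csSup hne hs
        exact (measure_mono (Set.inter_subset_inter_right _ (Set.Iio_subset_Iio hsx.le))).trans_lt
          hx.2
      have hct : sSup L ≤ t := csSup_le hne fun x hx => hx.1
      have hd' : d ≤ volume (F ∩ Set.Iio (sSup L)) := by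
        refine ENNReal.le_of_forall_pos_le_add fun ε hε _ => ?_
        have hε' : (0 : ℝ) < ε := hε
        rcases le_total (sSup L + ε) t with hle | hle
        · have : d ≤ volume (F ∩ Set.Iio (sSup L + ε)) := by
            by_contra! hlt
            linarith [le_csSup hbdd (show sSup L + ε ∈ L from ⟨hle, hlt⟩)]
          refine this.trans ((volume_inter_Iio_le_add F (x := sSup L)).trans ?_)
          rw [add_sub_cancel_left, ENNReal.ofReal_coe_nnreal]
        · refine hd.trans ((volume_inter_Iio_le_add F (x := sSup L)).trans ?_)
          gcongr
          rw [← ENNReal.ofReal_coe_nnreal]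
          exact ENNReal.ofReal_le_ofReal (by linarith)
      refine hd'.trans (measure_mono fun s hs => ⟨⟨hs.1, hlow s hs.2⟩, hs.2.trans_le hct⟩)
    · have hzero : volume (F ∩ Set.Iio (min a t)) = 0 := by
        refine (congrArg _ (Set.eq_empty_of_forall_notMem fun s hs => ?_)).trans measure_empty
        have h1 : a ≤ s := hF hs.1
        exact absurd (lt_min_iff.1 hs.2).1 (not_lt.2 h1)
      rcases eq_or_ne d 0 with rfl | hd0
      · exact zero_le
      · exact (hne ⟨min a t, min_le_right _ _, by rw [hzero]; exact hd0.bot_lt⟩).elim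
  · exact fun s hs => ⟨hs.1.1, hs.2⟩

/-- Every finite set of works with given arrival times and demands has a priority schedule. -/
theorem exists_schedule {β : Type*} [LinearOrder β] (prio : Work p q → β) (a d : Work p q → ℝ)
    (S : Finset (Work p q)) : ∃ σ : ℝ → Option (Work p q),
      (∀ w, MeasurableSet {t | σ t = some w}) ∧
      (∀ t w, σ t = some w → w ∈ S ∧ a w ≤ t ∧ service σ w t < ENNReal.ofReal (d w)) ∧
      (∀ t, ∀ w ∈ S, a w ≤ t → service σ w t < ENNReal.ofReal (d w) →
        ∃ v, σ t = some v ∧ prio v ≤ prio w) := by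
  classical
  induction S using Finset.induction_on_max_value prio with
  | empty => exact ⟨fun _ => none, by simp, by simp, by simp⟩
  | insert w S hwS hmax ih =>
    obtain ⟨σ, hmeas, hsome, hpend⟩ := ih
    -- Works are added in order of decreasing precedence, so the new one takes idle time after its
    -- arrival (`F`) until its demand is met (`E`) and disturbs nothing else.
    set F : Set ℝ := {t | σ t = none} ∩ Set.Ici (a w) with hF
    set E : Set ℝ := {t | t ∈ F ∧ volume (F ∩ Set.Iio t) < ENNReal.ofReal (d w)} with hE
    have hFm : MeasurableSet F := by
      refine MeasurableSet.inter ?_ measurableSet_Ici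
      have : {t | σ t = none} = (⋃ v ∈ S, {t | σ t = some v})ᶜ := by
        ext t
        simp only [Set.mem_ofPred_eq, Set.mem_compl_iff, Set.mem_iUnion, not_exists]
        refine ⟨fun h v _ hv => by simp [h] at hv, fun h => ?_⟩
        rcases hv : σ t with _ | v
        · rfl
        · exact (h v (hsome t v hv).1 hv).elim
      rw [this]
      exact (Finset.measurableSet_biUnion _ fun v _ => hmeas v).compl
    have hEm : MeasurableSet E := by
      refine hFm.inter (Set.OrdConnected.measurableSet (IsLowerSet.ordConnected ?_))
      exact fun x y hyx hx => (measure_mono (Set.inter_subset_inter_right _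
        (Set.Iio_subset_Iio hyx))).trans_lt hx
    set σ' : ℝ → Option (Work p q) := fun t => if t ∈ E then some w else σ t with hσ'
    have hnone : ∀ t ∈ E, σ t = none := fun t ht => ht.1.1
    have hnw : ∀ t, σ t ≠ some w := fun t ht => hwS (hsome t w ht).1
    have hset : {t | σ' t = some w} = E := by
      ext t
      by_cases ht : t ∈ E <;> simp [hσ', ht, hnw]
    have hset' : ∀ v, v ≠ w → {t | σ' t = some v} = {t | σ t = some v} := fun v hv => by
      ext t
      by_cases ht : t ∈ E
      · simp [hσ', ht, hnone t ht, hv.symm]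
      · simp [hσ', ht]
    have hserv : ∀ v, v ≠ w → ∀ t, service σ' v t = service σ v t := fun v hv t => by
      rw [service_eq, service_eq, hset' v hv]
    have hservw : ∀ t, service σ' w t < ENNReal.ofReal (d w) ↔
        volume (F ∩ Set.Iio t) < ENNReal.ofReal (d w) := fun t => by
      rw [service_eq, hset]
      exact volume_inter_Iio_lt_iff Set.inter_subset_right _ t
    refine ⟨σ', fun v => ?_, fun t v hv => ?_, fun t v hv hav hlt => ?_⟩
    · by_cases hvw : v = w
      · rw [hvw, hset]; exact hEm
      · rw [hset' v hvw]; exact hmeas v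
    · by_cases hvw : v = w
      · subst hvw
        have htE : t ∈ E := hset ▸ hv
        exact ⟨Finset.mem_insert_self _ _, htE.1.2, (hservw t).2 htE.2⟩
      · have hv' : t ∈ {t | σ t = some v} := hset' v hvw ▸ hv
        obtain ⟨h1, h2, h3⟩ := hsome t v hv'
        exact ⟨Finset.mem_insert_of_mem h1, h2, by rwa [hserv v hvw]⟩
    · have hkeep : ∀ u, σ t = some u → σ' t = some u := fun u hu => by
        have : t ∉ E := fun ht => by simp [hnone t ht] at hu
        simp [hσ', this, hu]
      by_cases hvw : v = w
      · subst hvw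
        rcases hu : σ t with _ | u
        · exact ⟨v, if_pos ⟨⟨hu, hav⟩, (hservw t).1 hlt⟩, le_rfl⟩
        · exact ⟨u, hkeep u hu, hmax u (hsome t u hu).1⟩
      · rw [hserv v hvw] at hlt
        obtain ⟨u, hu, hle⟩ := hpend t v (Finset.mem_of_mem_insert_of_ne hv hvw) hav hlt
        exact ⟨u, hkeep u hu, hle⟩

/-- Precedence as a number: the task first, then the index of the job. -/
def prio : Work p q → ℕ ×ₗ ℕ
  | .hp i k => toLex (i, k)
  -- One value suffices for all segments, since the synchronous pattern has only one segment with
  -- positive demand.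
  | .seg _ _ => toLex (p, 0)

theorem prio_hp_lt_of_higher {i : Fin p} {k : ℕ} {w : Work p q} (h : Higher (.hp i k) w) :
    prio (.hp i k : Work p q) < prio w := by
  cases w with
  | hp i' k' =>
    simp only [prio, Prod.Lex.toLex_lt_toLex]
    rcases h with h | ⟨rfl, h⟩
    · exact Or.inl h
    · exact Or.inr ⟨rfl, h⟩
  | seg k' j' =>
    simp only [prio, Prod.Lex.toLex_lt_toLex]
    exact Or.inl i.2

/-! ### Utilization below one, from synchronous releases. -/

namespace TaskSystem

variable (sys : TaskSystem p q)

/-- Synchronous periodic releases; higher-priority jobs released before `H` and the first segment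
of the first job of the self-suspending task take their worst-case execution times, and nothing
else takes any time. -/
noncomputable def synchronous (H : ℝ) : Pattern sys where
  rel i k := k * sys.T i
  exec i k := if k * sys.T i < H then sys.C i else 0
  relN k := k * sys.Tn
  execN k j := if k = 0 ∧ j = 0 then sys.Cn j else 0
  susp _ _ := 0
  rel_sep i k := by push_cast; linarith
  relN_sep k := by push_cast; linarith
  exec_nonneg i k := by split_ifs; exacts [(sys.C_pos i).le, le_rfl]
  exec_le i k := by split_ifs; exacts [le_rfl, (sys.C_pos i).le]
  execN_nonneg k j := by split_ifs; exacts [(sys.Cn_pos j).le, le_rfl]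
  execN_le k j := by split_ifs; exacts [le_rfl, (sys.Cn_pos j).le]
  susp_nonneg _ _ := le_rfl
  susp_le _ j := sys.Sn_nonneg j

/-- Only finitely many works have positive demand, and their arrivals do not depend on the schedule,
so `exists_schedule` covers everything that can be pending. -/
theorem exists_synchronous_schedule (H : ℝ) :
    ∃ σ, (sys.synchronous H).IsFPSchedule σ ∧ ∀ t w, σ t = some w → 0 ≤ t := by
  classical
  set P := sys.synchronous H with hP
  have hrel : ∀ i k, 0 ≤ P.rel i k := fun i k =>
    mul_nonneg (Nat.cast_nonneg k) (sys.T_pos i).le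
  let S : Finset (Work p q) := insert (.seg 0 0) (Finset.univ.biUnion fun i =>
    (Finset.range (P.count i H)).image fun k => Work.hp i k)
  have hS : ∀ w, 0 < P.demand w → w ∈ S := fun w hw => by
    rcases w with ⟨i, k⟩ | ⟨k, j⟩
    · have : P.rel i k < H := by
        by_contra hn
        exact hw.ne' (if_neg hn)
      simp only [S, Finset.mem_insert, Finset.mem_biUnion, Finset.mem_image, Finset.mem_range]
      exact Or.inr ⟨i, Finset.mem_univ i, k, P.lt_count_iff.2 this, rfl⟩
    · have : k = 0 ∧ j = 0 := by
        by_contra hn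
        exact hw.ne' (if_neg hn)
      obtain ⟨rfl, rfl⟩ := this
      exact Finset.mem_insert_self _ _
  have hcases : ∀ w ∈ S, (∃ i k, w = .hp i k) ∨ w = .seg 0 0 := fun w hw => by
    simp only [S, Finset.mem_insert, Finset.mem_biUnion, Finset.mem_image] at hw
    rcases hw with hw | ⟨i, _, k, _, hk⟩
    · exact Or.inr hw
    · exact Or.inl ⟨i, k, hk.symm⟩
  let a : Work p q → ℝ := fun w => match w with
    | .hp i k => P.rel i k
    | .seg k _ => P.relN k
  obtain ⟨σ, hmeas, hsome, hpend⟩ := exists_schedule prio a P.demand S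
  have harr : ∀ w ∈ S, P.arrival σ w = (a w : EReal) := fun w hw => by
    rcases hcases w hw with ⟨i, k, rfl⟩ | rfl <;> rfl
  have hpending : ∀ t w, P.Pending σ w t → w ∈ S ∧ ∃ v, σ t = some v ∧ prio v ≤ prio w := by
    rintro t w ⟨h1, h2⟩
    have hw : w ∈ S := hS w (ENNReal.ofReal_pos.1 (bot_le.trans_lt h2))
    rw [harr w hw, EReal.coe_le_coe_iff] at h1
    exact ⟨hw, hpend t w hw h1 h2⟩
  refine ⟨σ, ⟨hmeas, fun t w hw => ?_, fun t ht v hv => ?_⟩, fun t w hw => ?_⟩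
  · obtain ⟨hwS, haw, hlt⟩ := hsome t w hw
    refine ⟨⟨by rw [harr w hwS]; exact EReal.coe_le_coe_iff.2 haw, hlt⟩, fun v hv hvw => ?_⟩
    obtain ⟨hvS, u, hu, hle⟩ := hpending t v hv
    obtain rfl : w = u := Option.some.inj (hw.symm.trans hu)
    rcases hcases v hvS with ⟨i, k, rfl⟩ | rfl
    · exact absurd (prio_hp_lt_of_higher hvw) (not_lt.2 hle)
    · rcases hcases w hwS with ⟨i, k, rfl⟩ | rfl
      · exact hvw
      · simp [Higher] at hvw
  · obtain ⟨_, u, hu, _⟩ := hpending t v hv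
    simp [ht] at hu
  · obtain ⟨hwS, haw, _⟩ := hsome t w hw
    refine le_trans ?_ haw
    rcases hcases w hwS with ⟨i, k, rfl⟩ | rfl
    · exact hrel i k
    · simp [a, P, synchronous]

/-- With a utilization of at least one, synchronous higher-priority tasks keep the processor
busy. -/
theorem exists_hp_pending (hU : 1 ≤ ∑ i, sys.C i / sys.T i) {H : ℝ}
    {σ : ℝ → Option (Work p q)} (h : (sys.synchronous H).IsFPSchedule σ)
    (hpos : ∀ t w, σ t = some w → 0 ≤ t) {t : ℝ} (ht : 0 ≤ t) (htH : t < H) :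
    ∃ i k, (sys.synchronous H).Pending σ (.hp i k) t := by
  by_contra! hno
  have hdone : ∀ i, ∀ k ∈ Finset.range (⌊t / sys.T i⌋₊ + 1),
      ENNReal.ofReal (sys.C i) ≤ service σ (.hp i k) t := fun i k hk => by
    have hk' : k * sys.T i ≤ t := by
      rw [← le_div_iff₀ (sys.T_pos i), ← Nat.le_floor_iff (div_nonneg ht (sys.T_pos i).le)]
      exact Nat.lt_succ_iff.1 (Finset.mem_range.1 hk)
    by_contra! hlt
    refine hno i k ⟨EReal.coe_le_coe_iff.2 hk', ?_⟩
    have : (sys.synchronous H).demand (.hp i k) = sys.C i := if_pos (hk'.trans_lt htH)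
    rwa [this]
  -- Task `i` has ⌊t / T_i⌋ + 1 > t / T_i releases in [0, t]. Were all complete at `t`, their
  -- demand, strictly more than t times the utilization, would fit into [0, t).
  have hle : ENNReal.ofReal (∑ i, ((⌊t / sys.T i⌋₊ + 1 : ℕ) : ℝ) * sys.C i) ≤
      ENNReal.ofReal t := by
    calc ENNReal.ofReal (∑ i, ((⌊t / sys.T i⌋₊ + 1 : ℕ) : ℝ) * sys.C i)
        = ∑ i, ∑ _k ∈ Finset.range (⌊t / sys.T i⌋₊ + 1), ENNReal.ofReal (sys.C i) := by
          rw [ENNReal.ofReal_sum_of_nonneg fun i _ =>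
            mul_nonneg (Nat.cast_nonneg _) (sys.C_pos i).le]
          refine Finset.sum_congr rfl fun i _ => ?_
          rw [Finset.sum_const, Finset.card_range, ENNReal.ofReal_mul (Nat.cast_nonneg _),
            ENNReal.ofReal_natCast, nsmul_eq_mul]
      _ ≤ ∑ i, ∑ k ∈ Finset.range (⌊t / sys.T i⌋₊ + 1), service σ (.hp i k) t :=
          Finset.sum_le_sum fun i _ => Finset.sum_le_sum fun k hk => hdone i k hk
      _ = ∑ x ∈ Finset.univ.sigma fun i => Finset.range (⌊t / sys.T i⌋₊ + 1),
            service σ (.hp x.1 x.2) t :=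
          (Finset.sum_sigma _ _
            fun x : (_ : Fin p) × ℕ => service σ (.hp x.1 x.2) t).symm
      _ = volume (⋃ x ∈ Finset.univ.sigma fun i => Finset.range (⌊t / sys.T i⌋₊ + 1),
            {s | σ s = some (.hp x.1 x.2)} ∩ Set.Iio t) := by
          rw [measure_biUnion_finset]
          · simp only [service_eq]
          · rintro ⟨i, k⟩ _ ⟨i', k'⟩ _ hne
            refine Set.disjoint_left.2 fun s hs hs' => hne ?_
            have := hs.1.symm.trans hs'.1
            simp only [Option.some.injEq, Work.hp.injEq] at this
            obtain ⟨rfl, rfl⟩ := this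
            rfl
          · exact fun x _ => (h.measurable _).inter measurableSet_Iio
      _ ≤ volume (Set.Ico 0 t) := by
          refine measure_mono (Set.iUnion₂_subset fun x _ s hs => ⟨hpos s _ hs.1, hs.2⟩)
      _ = ENNReal.ofReal t := by rw [Real.volume_Ico, sub_zero]
  rw [ENNReal.ofReal_le_ofReal_iff ht] at hle
  have hne : (Finset.univ : Finset (Fin p)).Nonempty := by
    by_contra hemp
    rw [Finset.not_nonempty_iff_eq_empty] at hemp
    rw [hemp, Finset.sum_empty] at hU
    linarith
  have hlt : ∑ i, t * (sys.C i / sys.T i) <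
      ∑ i, ((⌊t / sys.T i⌋₊ + 1 : ℕ) : ℝ) * sys.C i := by
    refine Finset.sum_lt_sum_of_nonempty hne fun i _ => ?_
    have := mul_lt_mul_of_pos_right (Nat.lt_floor_add_one (t / sys.T i)) (sys.C_pos i)
    push_cast
    calc _ = t / sys.T i * sys.C i := by ring
      _ < _ := this
  rw [← Finset.mul_sum] at hlt
  nlinarith

theorem utilization_lt_one (h : sys.wcrt ≤ (sys.Tn : EReal)) :
    ∑ i, sys.C i / sys.T i < 1 := by
  by_contra! hU
  -- Any horizon beyond `Tn` would do: the first segment gets no service before `H`.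
  set H := sys.Tn + 1 with hH
  obtain ⟨σ, hσ, hpos⟩ := sys.exists_synchronous_schedule H
  set P := sys.synchronous H with hP
  have hserv : service σ (.seg 0 0) H = 0 := by
    refine (congrArg _ (Set.eq_empty_of_forall_notMem fun s hs => ?_)).trans measure_empty
    obtain ⟨i, k, hp⟩ := sys.exists_hp_pending hU hσ hpos (hpos s _ hs.2) hs.1
    exact (hσ.highest s _ hs.2).2 _ hp trivial
  have hfin : (H : EReal) ≤ P.segFinish σ 0 0 := by
    by_contra! hlt
    have h1 := le_service_of_finishFrom_lt hlt
    rw [hserv, nonpos_iff_eq_zero, ENNReal.ofReal_eq_zero] at h1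
    have h2 : P.execN 0 0 = sys.Cn 0 := by simp [P, synchronous]
    linarith [sys.Cn_pos 0]
  have hrelN : P.relN 0 = 0 := by simp [P, synchronous]
  have hresp : P.response σ 0 ≤ (sys.Tn : EReal) :=
    (le_sSup ⟨P, σ, hσ, 0, rfl⟩ : P.response σ 0 ≤ sys.wcrt).trans h
  rw [Pattern.response, hrelN, EReal.coe_zero, sub_zero] at hresp
  have := EReal.coe_le_coe_iff.1
    ((hfin.trans (P.segFinish_mono σ 0 (Fin.zero_le _))).trans hresp)
  linarith

end TaskSystem

theorem Pattern.IsFPSchedule.segFinish_le {sys : TaskSystem p q} {P : Pattern sys}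
    {σ : ℝ → Option (Work p q)} (hσ : P.IsFPSchedule σ) (h : sys.wcrt ≤ (sys.Tn : EReal))
    (k : ℕ) : P.segFinish σ k (Fin.last q) ≤ ((P.relN k + sys.Tn : ℝ) : EReal) := by
  have hresp : P.response σ k ≤ (sys.Tn : EReal) :=
    (le_sSup ⟨P, σ, hσ, k, rfl⟩ : P.response σ k ≤ sys.wcrt).trans h
  rw [Pattern.response, EReal.sub_le_iff_le_add (Or.inl (EReal.coe_ne_bot _))
    (Or.inl (EReal.coe_ne_top _)), ← EReal.coe_add, add_comm] at hresp
  exact hresp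

end SelfSusp

theorem mainTheorem6 {p q : ℕ} (sys : SelfSusp.TaskSystem p q)
    (h : sys.wcrt ≤ (sys.Tn : EReal)) :
    ∃ V : ℝ, IsGreatest sys.milpValues V ∧ sys.wcrt ≤ (V : EReal) := by
  obtain ⟨V, hV⟩ := sys.exists_isGreatest_milpValues (sys.utilization_lt_one h)
  refine ⟨V, hV, sSup_le ?_⟩
  rintro _ ⟨P, σ, hσ, k, rfl⟩
  obtain ⟨v, hv, hle⟩ := hσ.exists_milpValue (hσ.segFinish_le h) k
  exact hle.trans (EReal.coe_le_coe_iff.2 (hV.2 hv))
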